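/- Let $\mathcal U,\mathcal X,\mathcal Y,\hat{\mathcal U}$ be finite nonempty alphabets with $\mathcal X\supseteq\mathcal U$, let $P_U$ be a probability distribution on $\mathcal U$, let $P_{Y|X}$ be a memoryless channel from $\mathcal X$ to $\mathcal Y$, let $\Lambda:\mathcal U\times\hat{\mathcal U}\to[0,\infty)$ be a distortion function, and let $d\ge 1$. A lookahead-$d$ scheme (with noise-free unit-delay feedback and complete decoder memory) for the i.i.d. source $U_1,U_2,\dots\sim P_U$ consists of encoding maps $X_i=f_{e,i}(U^{i+d},Y^{i-1})\in\mathcal X$ and decoding maps $\hat U_i=f_{d,i}(Y^i)\in\hat{\mathcal U}$, $i\ge 1$, where $P(y_i\mid u_1^\infty,x^i,y^{i-1})=P_{Y|X}(y_i\mid x_i)$. It is optimal if it attains the infimum, over all lookahead-$d$ schemes, of $$\limsup_{N\to\infty}\mathbb E\Big[\frac1N\sum_{i=1}^N\Lambda(U_i,\hat U_i)\Big].$$ For a distribution $\beta$ on $\mathcal U$ let $B(\beta)=\min_{\hat u\in\hat{\mathcal U}}\sum_u\beta(u)\Lambda(u,\hat u)$, and let $f[\beta,y]$ be the posterior $u\mapsto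 \beta(u)P_{Y|X}(y|u)/\sum_{u'}\beta(u')P_{Y|X}(y|u')$. For a distribution $\beta$ on $\mathcal U^{d+1}$, a map $a:\mathcal U^{d+1}\to\mathcal X$ and $y\in\mathcal Y$ let $G(\beta,a,y)$ be the distribution on $\mathcal U^{d+1}$ with $$G(\beta,a,y)(\hat u_1^{d+1})\ \propto\ \Big(\sum_{u\in\mathcal U}\beta(u,\hat u_1,\dots,\hat u_d)\Big)P_U(\hat u_{d+1})\,P_{Y|X}(y\mid a(\hat u_1^{d+1})).$$ Write $\beta_k$ for the marginal of the $k$-th component of $\beta$. For $v=(u_1,\dots,u_{d+1})\in\mathcal U^{d+1}$ put, with $\tilde\beta=G(\beta,a,\tilde y)$, $$R_{v,\beta}(a)=\sum_{\tilde u\in\mathcal U,\ \tilde y\in\mathcal Y}P_U(\tilde u)P_{Y|X}(\tilde y\mid a(u_2^{d+1},\tilde u))\Big[B(\tilde\beta_1)+\sum_{k=2}^{d}\sum_{\hat y\in\mathcal Y}P_{Y|X}(\hat y|u_{k+1})B(f[\tilde\beta_k,\hat y])+\sum_{\hat y\in\mathcal Y}P_{Y|X}(\hat y|\tilde u)B(f[\tilde\beta_{d+1},\hat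 y])\Big].$$ Suppose that $$\sum_{u\in\mathcal U,\ y\in\mathcal Y}P_U(u)P_{Y|X}(y|u)B(f[P_U,y])+\sum_{k=2}^{d+1}\sum_{y\in\mathcal Y}P_{Y|X}(y|u_k)B(f[\beta_k,y])=\min_{a:\mathcal U^{d+1}\to\mathcal X}R_{v,\beta}(a)$$ for every $v=(u_1,\dots,u_{d+1})\in\mathcal U^{d+1}$ and every distribution $\beta$ on $\mathcal U^{d+1}$ with $\beta(v)>0$ (so that all posteriors that enter with positive weight are defined). Then uncoded symbol-by-symbol transmission $X_i=U_i$ is optimal among all lookahead-$d$ schemes: together with any decoder $\hat U_i=\delta(Y_i)$, where $\delta(y)$ minimizes $\hat u\mapsto\sum_u f[P_U,y](u)\Lambda(u,\hat u)$ for every output $y$ of positive probability (such a $\delta$ exists), it is an optimal scheme. -/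

import Mathlib

namespace RealTimeCoding

/-- A coding scheme with lookahead `d`, noise-free unit-delay feedback and a decoder with complete
memory. Times are `0, 1, 2, …`. At time `i` the channel input is `enc i (U_0, …, U_{i+d})
(Y_0, …, Y_{i-1})` and the reconstruction is `dec i (Y_0, …, Y_i)`. -/
structure Policy (U X Y R : Type*) (d : ℕ) where
  enc : ∀ i : ℕ, (Fin (i + d + 1) → U) → (Fin i → Y) → X
  dec : ∀ i : ℕ, (Fin (i + 1) → Y) → R

/-- The joint probability of the source symbols `U_0, …, U_{N+d-1}` and the channel outputs
`Y_0, …, Y_{N-1}` under a policy, for an i.i.d. source with law `PU` and a memoryless channel with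
transition probabilities `W x y`. -/
noncomputable def jointProb {U X Y R : Type*} [Fintype U] (PU : U → ℝ) (W : X → Y → ℝ) {d : ℕ}
    (π : Policy U X Y R d) (N : ℕ) (u : Fin (N + d) → U) (y : Fin N → Y) : ℝ :=
  (∏ j : Fin (N + d), PU (u j)) *
    ∏ i : Fin N,
      W (π.enc i (fun j => u (Fin.castLE (by omega) j)) (fun j => y (Fin.castLE (by omega) j)))
        (y i)

/-- The expected average distortion over the first `N` symbols,
`E [(1 / N) * ∑_{i < N} loss (U_i) (Û_i)]`. -/
noncomputable def avgDistortion {U X Y R : Type*} [Fintype U] [Fintype Y]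
    (PU : U → ℝ) (W : X → Y → ℝ) (loss : U → R → ℝ) {d : ℕ} (π : Policy U X Y R d) (N : ℕ) : ℝ :=
  ∑ u : Fin (N + d) → U, ∑ y : Fin N → Y,
    jointProb PU W π N u y *
      ((1 / (N : ℝ)) *
        ∑ i : Fin N, loss (u (Fin.castAdd d i)) (π.dec i (fun j => y (Fin.castLE (by omega) j))))

/-- The long-run expected average distortion of a policy. -/
noncomputable def distortion {U X Y R : Type*} [Fintype U] [Fintype Y]
    (PU : U → ℝ) (W : X → Y → ℝ) (loss : U → R → ℝ) {d : ℕ} (π : Policy U X Y R d) : ℝ :=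
  Filter.limsup (fun N : ℕ => avgDistortion PU W loss π N) Filter.atTop

/-- `D(d)`, the minimum expected average distortion with lookahead `d`. -/
noncomputable def minDistortion {U X Y R : Type*} [Fintype U] [Fintype Y]
    (PU : U → ℝ) (W : X → Y → ℝ) (loss : U → R → ℝ) (d : ℕ) : ℝ :=
  ⨅ π : Policy U X Y R d, distortion PU W loss π

/-- The set of `d`-distortion optimal policies. -/
def optimalPolicies {U X Y R : Type*} [Fintype U] [Fintype Y]
    (PU : U → ℝ) (W : X → Y → ℝ) (loss : U → R → ℝ) (d : ℕ) : Set (Policy U X Y R d) :=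
  {π | distortion PU W loss π = minDistortion PU W loss d}

/-- The stationary symbol by symbol policy `X_i = μ (U_i)`, `Û_i = δ (Y_i)`, seen as a policy with
lookahead `d`. -/
def symbolPolicy {U X Y R : Type*} (μ : U → X) (δ : Y → R) (d : ℕ) : Policy U X Y R d where
  enc i u _ := μ (u ⟨i, by omega⟩)
  dec i y := δ (y (Fin.last i))

/-- `r` minimizes the expected loss when the source symbol has law `β`. -/
def IsBayesResponse {U R : Type*} [Fintype U] (loss : U → R → ℝ) (β : U → ℝ) (r : R) : Prop :=
  ∀ r' : R, ∑ u, β u * loss u r ≤ ∑ u, β u * loss u r'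

/-- The Bayes envelope `B(β)`. -/
noncomputable def bayesEnvelope {U R : Type*} [Fintype U] (loss : U → R → ℝ) (β : U → ℝ) : ℝ :=
  ⨅ r : R, ∑ u, β u * loss u r

/-- The posterior `f_μ[β, y]` of a source symbol with prior `β` that is sent as `μ u` through the
channel `W` when the output is `y`. (The zero function if `y` has probability zero.) -/
noncomputable def posterior {U X Y : Type*} [Fintype U] (W : X → Y → ℝ) (μ : U → X)
    (β : U → ℝ) (y : Y) : U → ℝ :=
  fun u => β u * W (μ u) y / ∑ u', β u' * W (μ u') y

/-- The transition kernel of the Markov source `V_i = (U_i, …, U_{i+d})`: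
`K (u_1, …, u_{d+1}) (ũ_1, …, ũ_{d+1})` is `PU ũ_{d+1}` if `(u_2, …, u_{d+1}) = (ũ_1, …, ũ_d)`
and zero otherwise. -/
def shiftKernel {U : Type*} [DecidableEq U] (PU : U → ℝ) {d : ℕ} (v v' : Fin (d + 1) → U) : ℝ :=
  if (∀ j : Fin d, v j.succ = v' j.castSucc) then PU (v' (Fin.last d)) else 0

/-- The belief update `G(β, a, y)`. (The zero function if `y` has probability zero.) -/
noncomputable def beliefUpdate {U X Y : Type*} [Fintype U] [DecidableEq U]
    (PU : U → ℝ) (W : X → Y → ℝ) {d : ℕ}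
    (β : (Fin (d + 1) → U) → ℝ) (a : (Fin (d + 1) → U) → X) (y : Y) : (Fin (d + 1) → U) → ℝ :=
  fun v =>
    (∑ v', β v' * shiftKernel PU v' v) * W (a v) y /
      ∑ w, (∑ v', β v' * shiftKernel PU v' w) * W (a w) y

/-- The law of the component `k` under a law `β` on `U^(d+1)`. Components are numbered `0, …, d`,
so that `marginal β k` is `β_{k+1}` in one-based numbering. -/
def marginal {U : Type*} [Fintype U] [DecidableEq U] {d : ℕ}
    (β : (Fin (d + 1) → U) → ℝ) (k : Fin (d + 1)) : U → ℝ :=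
  fun u => ∑ v : Fin (d + 1) → U with v k = u, β v

/-- The left-hand side of the optimality condition for the symbol by symbol encoder `μ`, at the
state `(v, β)` with `v = (u_1, …, u_{d+1})`:
`∑_{u,y} PU(u) W(y|μ(u)) B(f_μ[PU,y]) + ∑_{k=2}^{d+1} ∑_y W(y|μ(u_k)) B(f_μ[β_k,y])`. -/
noncomputable def condLHS {U X Y R : Type*} [Fintype U] [DecidableEq U] [Fintype Y]
    (PU : U → ℝ) (W : X → Y → ℝ) (loss : U → R → ℝ) (μ : U → X) {d : ℕ}
    (v : Fin (d + 1) → U) (β : (Fin (d + 1) → U) → ℝ) : ℝ :=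
  (∑ u : U, ∑ y : Y, PU u * W (μ u) y * bayesEnvelope loss (posterior W μ PU y)) +
    ∑ k : Fin d, ∑ y : Y,
      W (μ (v k.succ)) y * bayesEnvelope loss (posterior W μ (marginal β k.succ) y)

/-- The right-hand side of the optimality condition for the symbol by symbol encoder `μ`, at the
state `(v, β)` with `v = (u_1, …, u_{d+1})`, as a function of the action `a`. With
`β̃ = G(β, a, ỹ)` it is the sum over `ũ, ỹ` of `PU(ũ) W(ỹ|a(u_2, …, u_{d+1}, ũ))` times
`B(β̃_1) + ∑_{k=2}^{d} ∑_ŷ W(ŷ|μ(u_{k+1})) B(f_μ[β̃_k,ŷ]) + ∑_ŷ W(ŷ|μ(ũ)) B(f_μ[β̃_{d+1},ŷ])`. -/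
noncomputable def condRHS {U X Y R : Type*} [Fintype U] [DecidableEq U] [Fintype Y]
    (PU : U → ℝ) (W : X → Y → ℝ) (loss : U → R → ℝ) (μ : U → X) {d : ℕ}
    (v : Fin (d + 1) → U) (β : (Fin (d + 1) → U) → ℝ) (a : (Fin (d + 1) → U) → X) : ℝ :=
  (∑ u : U, ∑ y : Y,
    PU u * W (a (Fin.snoc (α := fun _ => U) (Fin.tail v) u)) y *
      bayesEnvelope loss (marginal (beliefUpdate PU W β a y) 0)) +
  (∑ u : U, ∑ y : Y,
    PU u * W (a (Fin.snoc (α := fun _ => U) (Fin.tail v) u)) y *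
      ∑ k ∈ (Finset.univ : Finset (Fin d)).filter (fun k : Fin d => 1 ≤ (k : ℕ)), ∑ z : Y,
        W (μ (v k.succ)) z *
          bayesEnvelope loss (posterior W μ (marginal (beliefUpdate PU W β a y) k.castSucc) z)) +
  (∑ u : U, ∑ y : Y,
    PU u * W (a (Fin.snoc (α := fun _ => U) (Fin.tail v) u)) y *
      ∑ z : Y,
        W (μ u) z *
          bayesEnvelope loss (posterior W μ (marginal (beliefUpdate PU W β a y) (Fin.last d)) z))

end RealTimeCoding

/-! The proof is a potential argument. Let L be the loss of one uncoded symbol (`uncodedLoss`). For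
a law b of the d source symbols already known to the encoder but not yet due at the decoder, let
Φ(b) be the total loss of sending each of them once uncoded, with its marginal of b as prior
(`potential`).

Averaging the hypothesis over v with law β turns its left side into L + Φ(b), where b is the law of
the last d components of β. The right side becomes `stepValue`: the Bayes loss of the symbol now due
after one channel use with action a, plus the expected Φ of the updated belief about the other d
symbols (`sum_mul_condLHS`, `sum_mul_condRHS`). Thus L + Φ is at most `stepValue` for every
deterministic action.

In a general scheme the input also depends on older source symbols, so given the past outputs the
current window acts through a mixture of rows of W. Since `stepValue` is concave in the joint
weights, the bound extends to such mixtures (`uncodedLoss_add_potential_le_of_mem_convexHull`).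
Hence L + E Φ_N ≤ E loss_N + E Φ_{N+1} for every scheme. Telescoping with 0 ≤ E Φ_N ≤ d M, where M
bounds the distortion function, gives N L - d M ≤ total loss, so every scheme has distortion at
least L. The uncoded scheme attains L.

Beliefs are carried as unnormalized joint weights: the Bayes envelope is positively homogeneous, so
no conditioning on outputs is needed. -/

namespace RealTimeCoding

open Finset

/-! ### Sums over tuples and coordinate marginals -/

section Sums

variable {U : Type*} [Fintype U]

theorem sum_fun_snoc {n : ℕ} (f : (Fin (n + 1) → U) → ℝ) :
    ∑ v, f v = ∑ w : Fin n → U, ∑ s : U, f (Fin.snoc (α := fun _ => U) w s) := by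
  rw [← Equiv.sum_comp (Fin.snocEquiv (fun _ : Fin (n + 1) => U)) f, Fintype.sum_prod_type,
    Finset.sum_comm]
  rfl

theorem sum_fun_cons {n : ℕ} (f : (Fin (n + 1) → U) → ℝ) :
    ∑ v, f v = ∑ s : U, ∑ w : Fin n → U, f (Fin.cons (α := fun _ => U) s w) := by
  rw [← Equiv.sum_comp (Fin.consEquiv (fun _ : Fin (n + 1) => U)) f, Fintype.sum_prod_type]
  rfl

theorem sum_fun_append {m n : ℕ} (f : (Fin (m + n) → U) → ℝ) :
    ∑ u, f u = ∑ p : Fin m → U, ∑ w : Fin n → U, f (Fin.append p w) := by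
  rw [← Equiv.sum_comp (Fin.appendEquiv m n) f, Fintype.sum_prod_type]
  rfl

/-- The (unnormalized) law of the coordinate `k` under a weight function on tuples. -/
def coordLaw [DecidableEq U] {n : ℕ} (m : (Fin n → U) → ℝ) (k : Fin n) : U → ℝ :=
  fun u => ∑ v : Fin n → U with v k = u, m v

variable [DecidableEq U]

theorem sum_coordLaw_mul {n : ℕ} (m : (Fin n → U) → ℝ) (k : Fin n) (g : U → ℝ) :
    ∑ u, coordLaw m k u * g u = ∑ v, m v * g (v k) := by
  rw [← Finset.sum_fiberwise univ (fun v : Fin n → U => v k) (fun v => m v * g (v k))]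
  refine Finset.sum_congr rfl fun u _ => ?_
  rw [coordLaw, Finset.sum_mul]
  refine Finset.sum_congr rfl fun v hv => ?_
  rw [(Finset.mem_filter.1 hv).2]

theorem sum_coordLaw {n : ℕ} (m : (Fin n → U) → ℝ) (k : Fin n) :
    ∑ u, coordLaw m k u = ∑ v, m v := by
  simpa using sum_coordLaw_mul m k (fun _ => 1)

theorem coordLaw_nonneg {n : ℕ} {m : (Fin n → U) → ℝ} (hm : ∀ v, 0 ≤ m v) (k : Fin n) (u : U) :
    0 ≤ coordLaw m k u :=
  Finset.sum_nonneg fun v _ => hm v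

theorem coordLaw_div {n : ℕ} (m : (Fin n → U) → ℝ) (r : ℝ) (k : Fin n) (u : U) :
    coordLaw (fun v => m v / r) k u = coordLaw m k u / r := by
  rw [coordLaw, coordLaw, Finset.sum_div]

theorem coordLaw_cons {n : ℕ} (m : (Fin (n + 1) → U) → ℝ) (k : Fin n) :
    coordLaw (fun w => ∑ s, m (Fin.cons (α := fun _ => U) s w)) k = coordLaw m k.succ := by
  funext u
  simp only [coordLaw, Finset.sum_filter]
  rw [sum_fun_cons, Finset.sum_comm]
  refine Finset.sum_congr rfl fun w _ => ?_
  simp only [Fin.cons_succ]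
  split_ifs <;> simp

end Sums

/-! ### The Bayes envelope: homogeneity and concavity -/

section Envelope

variable {U R : Type*} [Fintype U] (loss : U → R → ℝ)

theorem bayesEnvelope_le [Finite R] (q : U → ℝ) (r : R) :
    bayesEnvelope loss q ≤ ∑ u, q u * loss u r :=
  ciInf_le (Set.finite_range _).bddBelow r

theorem bayesEnvelope_const_mul {s : ℝ} (hs : 0 ≤ s) (q : U → ℝ) :
    bayesEnvelope loss (fun u => s * q u) = s * bayesEnvelope loss q := by
  rw [bayesEnvelope, bayesEnvelope, Real.mul_iInf_of_nonneg hs]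
  simp only [Finset.mul_sum, mul_assoc]

theorem bayesEnvelope_zero [Nonempty R] : bayesEnvelope loss (fun _ => 0) = 0 := by
  simp [bayesEnvelope]

/-- Homogeneity removes the normalization. If the mass is zero then q itself vanishes, so the
convention x / 0 = 0 does no harm. -/
theorem sum_mul_bayesEnvelope_div {q : U → ℝ} (hq : ∀ u, 0 ≤ q u) :
    (∑ u, q u) * bayesEnvelope loss (fun u => q u / ∑ u', q u') = bayesEnvelope loss q := by
  rw [← bayesEnvelope_const_mul loss (Finset.sum_nonneg fun u _ => hq u)]
  congr 1
  funext u
  by_cases h : ∑ u', q u' = 0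
  · rw [(Finset.sum_eq_zero_iff_of_nonneg fun u _ => hq u).1 h u (mem_univ u)]; simp
  · field_simp

/-- An infimum of linear functionals is concave; by homogeneity s + t = 1 is not needed. -/
theorem bayesEnvelope_concave [Finite R] [Nonempty R] {s t : ℝ} (hs : 0 ≤ s) (ht : 0 ≤ t)
    (p q : U → ℝ) :
    s * bayesEnvelope loss p + t * bayesEnvelope loss q ≤
      bayesEnvelope loss (fun u => s * p u + t * q u) := by
  refine le_ciInf fun r => ?_
  have h1 := mul_le_mul_of_nonneg_left (bayesEnvelope_le loss p r) hs
  have h2 := mul_le_mul_of_nonneg_left (bayesEnvelope_le loss q r) ht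
  refine (add_le_add h1 h2).trans_eq ?_
  rw [Finset.mul_sum, Finset.mul_sum, ← Finset.sum_add_distrib]
  exact Finset.sum_congr rfl fun u _ => by ring

theorem bayesEnvelope_nonneg [Nonempty R] (hloss : ∀ u r, 0 ≤ loss u r) {q : U → ℝ}
    (hq : ∀ u, 0 ≤ q u) :
    0 ≤ bayesEnvelope loss q :=
  le_ciInf fun r => Finset.sum_nonneg fun u _ => mul_nonneg (hq u) (hloss u r)

theorem IsBayesResponse.bayesEnvelope_eq [Finite R] [Nonempty R] {loss : U → R → ℝ}
    {β : U → ℝ} {r : R}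
    (h : IsBayesResponse loss β r) : bayesEnvelope loss β = ∑ u, β u * loss u r :=
  le_antisymm (bayesEnvelope_le loss β r) (le_ciInf h)

theorem sum_mul_envelope_posterior {X Y : Type*} {W : X → Y → ℝ} (c : U → X)
    (hW : ∀ x y, 0 ≤ W x y) {q : U → ℝ} (hq : ∀ u, 0 ≤ q u)
    (z : Y) :
    (∑ u, q u * W (c u) z) * bayesEnvelope loss (posterior W c q z) =
      bayesEnvelope loss (fun u => q u * W (c u) z) :=
  sum_mul_bayesEnvelope_div loss fun u => mul_nonneg (hq u) (hW _ z)

end Envelope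

/-! ### The optimality condition averaged over the state -/

section OneStep

variable {U X Y R : Type*} [Fintype U] [DecidableEq U] [Fintype Y]
  (PU : U → ℝ) (W : X → Y → ℝ) (loss : U → R → ℝ) (c : U → X)

/-- The expected loss of one uncoded symbol with the best symbol by symbol decoder. -/
noncomputable def uncodedLoss : ℝ :=
  ∑ u : U, ∑ y : Y, PU u * W (c u) y * bayesEnvelope loss (posterior W c PU y)

/-- The expected loss of transmitting each coordinate of a tuple with weights `m` uncoded and
estimating it from its own channel output. -/
noncomputable def potential {n : ℕ} (m : (Fin n → U) → ℝ) : ℝ :=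
  ∑ k, ∑ z, bayesEnvelope loss (fun u => coordLaw m k u * W (c u) z)

/-- The expected loss for the coordinate `0`, plus the potential of the other ones, after an
observation `y` with joint weights `J v y`. -/
noncomputable def stepValue {d : ℕ} (J : (Fin (d + 1) → U) → Y → ℝ) : ℝ :=
  ∑ y, (bayesEnvelope loss (coordLaw (fun v => J v y) 0) +
    ∑ k : Fin d, ∑ z, bayesEnvelope loss
      (fun u => coordLaw (fun v => J v y) k.succ u * W (c u) z))

variable {W}

/-- In terms of the shifted window (u_2, …, u_{d+1}, ũ), the sum over the old components and the
separate term for ũ merge into one sum over the components after the first. -/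
theorem condRHS_eq {d : ℕ} (hd : 1 ≤ d) (v : Fin (d + 1) → U) (β : (Fin (d + 1) → U) → ℝ)
    (a : (Fin (d + 1) → U) → X) :
    condRHS PU W loss c v β a = ∑ s : U, PU s * ∑ y : Y,
      W (a (Fin.snoc (α := fun _ => U) (Fin.tail v) s)) y *
        (bayesEnvelope loss (coordLaw (beliefUpdate PU W β a y) 0) +
          ∑ k : Fin d, ∑ z, W (c (Fin.snoc (α := fun _ => U) (Fin.tail v) s k.succ)) z *
            bayesEnvelope loss
              (posterior W c (coordLaw (beliefUpdate PU W β a y) k.succ) z)) := by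
  obtain ⟨e, rfl⟩ : ∃ e, d = e + 1 := ⟨d - 1, by omega⟩
  rw [condRHS, ← Finset.sum_add_distrib, ← Finset.sum_add_distrib]
  refine Finset.sum_congr rfl fun s _ => ?_
  rw [← Finset.sum_add_distrib, ← Finset.sum_add_distrib, Finset.mul_sum]
  refine Finset.sum_congr rfl fun y _ => ?_
  rw [Finset.sum_filter, Fin.sum_univ_succ, Fin.sum_univ_castSucc (n := e)]
  simp only [Fin.val_zero, Fin.val_succ, nonpos_iff_eq_zero, one_ne_zero, if_false, zero_add,
    Nat.le_add_left, if_true, Fin.succ_castSucc, Fin.succ_last, Fin.snoc_castSucc, Fin.snoc_last,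
    Fin.tail]
  simp only [mul_add, add_assoc, mul_assoc]
  rfl

theorem sum_mul_shift {d : ℕ} {β : (Fin (d + 1) → U) → ℝ} (φ : (Fin (d + 1) → U) → ℝ) :
    ∑ v, β v * ∑ s, PU s * φ (Fin.snoc (α := fun _ => U) (Fin.tail v) s) =
      ∑ v, (∑ v', β v' * shiftKernel PU v' v) * φ v := by
  simp only [Finset.sum_mul]
  rw [Finset.sum_comm (γ := Fin (d + 1) → U)]
  refine Finset.sum_congr rfl fun v _ => ?_
  simp only [mul_assoc, ← Finset.mul_sum]
  rw [sum_fun_snoc (fun v' => shiftKernel PU v v' * φ v')]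
  congr 1
  rw [Finset.sum_eq_single (Fin.tail v)]
  · refine Finset.sum_congr rfl fun s _ => ?_
    simp [shiftKernel, Fin.tail]
  · intro w _ hw
    refine Finset.sum_eq_zero fun s _ => ?_
    rw [shiftKernel, if_neg, zero_mul]
    intro h
    refine hw (funext fun j => ?_)
    simpa [Fin.tail] using (h j).symm
  · simp

/-- Averaging W(z | c(u_k)) over β produces exactly the normalizing constant of the posterior of
component k, which the envelope absorbs. -/
theorem sum_mul_condLHS (hW : ∀ x y, 0 ≤ W x y) {d : ℕ} {β : (Fin (d + 1) → U) → ℝ}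
    (hβ : ∀ v, 0 ≤ β v) :
    ∑ v, β v * condLHS PU W loss c v β = (∑ v, β v) * uncodedLoss PU W loss c +
      ∑ k : Fin d, ∑ z, bayesEnvelope loss (fun u => coordLaw β k.succ u * W (c u) z) := by
  simp only [condLHS, mul_add, Finset.sum_add_distrib]
  congr 1
  · rw [← Finset.sum_mul]; rfl
  · simp only [Finset.mul_sum]
    rw [Finset.sum_comm]
    refine Finset.sum_congr rfl fun k _ => ?_
    rw [Finset.sum_comm]
    refine Finset.sum_congr rfl fun z _ => ?_
    rw [← sum_mul_envelope_posterior loss c hW (coordLaw_nonneg hβ k.succ),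
      sum_coordLaw_mul β k.succ (fun u => W (c u) z), Finset.sum_mul]
    exact Finset.sum_congr rfl fun v _ => by rw [← mul_assoc]; rfl

theorem sum_mul_condRHS (hW : ∀ x y, 0 ≤ W x y) (hPU : ∀ u, 0 ≤ PU u) {d : ℕ} (hd : 1 ≤ d)
    {β : (Fin (d + 1) → U) → ℝ} (hβ : ∀ v, 0 ≤ β v) (a : (Fin (d + 1) → U) → X) :
    ∑ v, β v * condRHS PU W loss c v β a =
      stepValue W loss c (fun v y => (∑ v', β v' * shiftKernel PU v' v) * W (a v) y) := by
  simp only [condRHS_eq PU loss c hd]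
  rw [sum_mul_shift PU (fun v => ∑ y : Y, W (a v) y *
        (bayesEnvelope loss (coordLaw (beliefUpdate PU W β a y) 0) +
          ∑ k : Fin d, ∑ z, W (c (v k.succ)) z *
            bayesEnvelope loss
              (posterior W c (coordLaw (beliefUpdate PU W β a y) k.succ) z)))]
  have hn : ∀ v, 0 ≤ ∑ v', β v' * shiftKernel PU v' v := fun v =>
    Finset.sum_nonneg fun v' _ => mul_nonneg (hβ v') (by
      rw [shiftKernel]; split_ifs <;> simp [hPU])
  simp only [Finset.mul_sum]
  rw [Finset.sum_comm, stepValue]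
  refine Finset.sum_congr rfl fun y _ => ?_
  simp only [← mul_assoc]
  set m : (Fin (d + 1) → U) → ℝ := fun v => (∑ v', β v' * shiftKernel PU v' v) * W (a v) y
    with hm
  have hm0 : ∀ v, 0 ≤ m v := fun v => mul_nonneg (hn v) (hW _ y)
  have hG : beliefUpdate PU W β a y = fun v => m v / ∑ w, m w := rfl
  simp only [mul_add, Finset.sum_add_distrib]
  rw [hG]
  have hM : ∀ v, (∑ v', β v' * shiftKernel PU v' v) * W (a v) y = m v := fun v => rfl
  simp only [hM, Finset.mul_sum]
  congr 1
  · rw [← Finset.sum_mul]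
    rw [← sum_mul_bayesEnvelope_div loss (coordLaw_nonneg hm0 0), sum_coordLaw]
    congr 2
    funext u
    exact coordLaw_div m _ 0 u
  · rw [Finset.sum_comm]
    refine Finset.sum_congr rfl fun k _ => ?_
    rw [Finset.sum_comm]
    refine Finset.sum_congr rfl fun z _ => ?_
    rw [← sum_mul_envelope_posterior loss c hW (coordLaw_nonneg hm0 k.succ),
      sum_coordLaw_mul m k.succ (fun u => W (c u) z), Finset.sum_mul]
    -- An output of probability zero carries no weight on either side.
    by_cases hZ : ∑ w, m w = 0
    · have := (Finset.sum_eq_zero_iff_of_nonneg fun u _ => hm0 u).1 hZ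
      exact Finset.sum_congr rfl fun v _ => by rw [this v (mem_univ v)]; simp
    · refine Finset.sum_congr rfl fun v _ => ?_
      rw [← mul_assoc]
      congr 2
      -- The posterior does not change when its prior is rescaled, so the normalization inside
      -- `beliefUpdate` cancels.
      funext u
      simp only [posterior, coordLaw_div, div_mul_eq_mul_div]
      rw [← Finset.sum_div, div_div_div_cancel_right₀ hZ]

theorem potential_nonneg [Nonempty R] (hloss : ∀ u r, 0 ≤ loss u r) (hW : ∀ x y, 0 ≤ W x y)
    {n : ℕ} {m : (Fin n → U) → ℝ} (hm : ∀ v, 0 ≤ m v) : 0 ≤ potential W loss c m :=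
  Finset.sum_nonneg fun k _ => Finset.sum_nonneg fun z _ =>
    bayesEnvelope_nonneg loss hloss fun u => mul_nonneg (coordLaw_nonneg hm k u) (hW _ z)

/-- The condition of optimality, averaged over the state `v`. -/
theorem le_stepValue_of_mem_stdSimplex (hW : ∀ x y, 0 ≤ W x y) (hPU : ∀ u, 0 ≤ PU u)
    {d : ℕ} (hd : 1 ≤ d)
    (hcond : ∀ (v : Fin (d + 1) → U), ∀ β ∈ stdSimplex ℝ (Fin (d + 1) → U), 0 < β v →
      ∀ a, condLHS PU W loss c v β ≤ condRHS PU W loss c v β a)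
    {β : (Fin (d + 1) → U) → ℝ} (hβ : β ∈ stdSimplex ℝ (Fin (d + 1) → U))
    (a : (Fin (d + 1) → U) → X) :
    uncodedLoss PU W loss c +
        ∑ k : Fin d, ∑ z, bayesEnvelope loss (fun u => coordLaw β k.succ u * W (c u) z) ≤
      stepValue W loss c (fun v y => (∑ v', β v' * shiftKernel PU v' v) * W (a v) y) := by
  have h : ∑ v, β v * condLHS PU W loss c v β ≤ ∑ v, β v * condRHS PU W loss c v β a := by
    refine Finset.sum_le_sum fun v _ => ?_
    rcases (hβ.1 v).eq_or_lt with h0 | h0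
    · simp [← h0]
    · exact mul_le_mul_of_nonneg_left (hcond v β hβ h0 a) h0.le
  rwa [sum_mul_condLHS PU loss c hW hβ.1, hβ.2, one_mul,
    sum_mul_condRHS PU loss c hW hPU hd hβ.1] at h

end OneStep

/-! ### From deterministic actions to mixed channels -/

section Mixture

variable {U X Y R : Type*} [Fintype U] [DecidableEq U] [Fintype Y]
  (PU : U → ℝ) {W : X → Y → ℝ} (loss : U → R → ℝ) (c : U → X)

theorem coordLaw_linear_comb {n : ℕ} (s t : ℝ) (m m' : (Fin n → U) → ℝ) (k : Fin n) (u : U) :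
    coordLaw (fun v => s * m v + t * m' v) k u = s * coordLaw m k u + t * coordLaw m' k u := by
  simp only [coordLaw, Finset.sum_add_distrib, Finset.mul_sum]

/-- The one-step inequality for a deterministic action and a weight function of total mass one. -/
theorem uncodedLoss_add_potential_le (hW : ∀ x y, 0 ≤ W x y) (hPU : PU ∈ stdSimplex ℝ U)
    {d : ℕ} (hd : 1 ≤ d)
    (hcond : ∀ (v : Fin (d + 1) → U), ∀ β ∈ stdSimplex ℝ (Fin (d + 1) → U), 0 < β v →
      ∀ a, condLHS PU W loss c v β ≤ condRHS PU W loss c v β a)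
    {b : (Fin d → U) → ℝ} (hb : b ∈ stdSimplex ℝ (Fin d → U)) (a : (Fin (d + 1) → U) → X) :
    uncodedLoss PU W loss c + potential W loss c b ≤
      stepValue W loss c (fun v y => b (Fin.init v) * PU (v (Fin.last d)) * W (a v) y) := by
  -- The shift forgets component 0, so any probability law works there; an independent symbol of law
  -- PU is prepended.
  set β : (Fin (d + 1) → U) → ℝ := fun v => PU (v 0) * b (Fin.tail v) with hβ
  have hmem : β ∈ stdSimplex ℝ (Fin (d + 1) → U) := by
    refine ⟨fun v => mul_nonneg (hPU.1 _) (hb.1 _), ?_⟩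
    rw [sum_fun_cons]
    simp only [hβ, Fin.cons_zero, Fin.tail_cons]
    simp only [← Finset.mul_sum, hb.2, mul_one, hPU.2]
  have h := le_stepValue_of_mem_stdSimplex PU loss c hW hPU.1 hd hcond hmem a
  have h1 : ∀ k : Fin d, coordLaw β k.succ = coordLaw b k := by
    intro k
    rw [← coordLaw_cons]
    congr 1
    funext w
    simp only [hβ, Fin.cons_zero, Fin.tail_cons]
    rw [← Finset.sum_mul, hPU.2, one_mul]
  have h2 : ∀ v, ∑ v', β v' * shiftKernel PU v' v = b (Fin.init v) * PU (v (Fin.last d)) := by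
    intro v
    rw [sum_fun_cons, Finset.sum_comm, Finset.sum_eq_single (Fin.init v)]
    · have : ∀ s, shiftKernel PU (Fin.cons (α := fun _ => U) s (Fin.init v)) v =
          PU (v (Fin.last d)) := fun s => if_pos fun j => by simp [Fin.init]
      simp only [hβ, Fin.cons_zero, Fin.tail_cons, this]
      rw [← Finset.sum_mul, ← Finset.sum_mul, hPU.2, one_mul]
    · intro w _ hw
      refine Finset.sum_eq_zero fun s _ => ?_
      rw [shiftKernel, if_neg, mul_zero]
      exact fun h => hw (funext fun j => by simpa [Fin.init] using h j)
    · simp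
  simp only [h1, h2] at h
  exact h

variable [Finite R] [Nonempty R]

theorem stepValue_concave {d : ℕ} {s t : ℝ} (hs : 0 ≤ s) (ht : 0 ≤ t)
    (J J' : (Fin (d + 1) → U) → Y → ℝ) :
    s * stepValue W loss c J + t * stepValue W loss c J' ≤
      stepValue W loss c (fun v y => s * J v y + t * J' v y) := by
  simp only [stepValue, Finset.mul_sum, mul_add, ← Finset.sum_add_distrib]
  refine Finset.sum_le_sum fun y _ => ?_
  rw [add_add_add_comm]
  refine add_le_add ?_ ?_
  · refine (bayesEnvelope_concave loss hs ht _ _).trans_eq ?_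
    congr 1
    funext u
    exact (coordLaw_linear_comb s t _ _ 0 u).symm
  · rw [← Finset.sum_add_distrib]
    refine Finset.sum_le_sum fun k _ => ?_
    rw [← Finset.sum_add_distrib]
    refine Finset.sum_le_sum fun z _ => ?_
    refine (bayesEnvelope_concave loss hs ht _ _).trans_eq ?_
    congr 1
    funext u
    rw [coordLaw_linear_comb s t _ _ k.succ u]
    ring

theorem uncodedLoss_add_potential_le_of_mem_convexHull (hW : ∀ x y, 0 ≤ W x y)
    (hPU : PU ∈ stdSimplex ℝ U) {d : ℕ} (hd : 1 ≤ d)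
    (hcond : ∀ (v : Fin (d + 1) → U), ∀ β ∈ stdSimplex ℝ (Fin (d + 1) → U), 0 < β v →
      ∀ a, condLHS PU W loss c v β ≤ condRHS PU W loss c v β a)
    {b : (Fin d → U) → ℝ} (hb : b ∈ stdSimplex ℝ (Fin d → U)) (Q : (Fin (d + 1) → U) → Y → ℝ)
    (hQ : ∀ v, Q v ∈ convexHull ℝ (Set.range W)) :
    uncodedLoss PU W loss c + potential W loss c b ≤
      stepValue W loss c (fun v y => b (Fin.init v) * PU (v (Fin.last d)) * Q v y) := by
  let S : Set ((Fin (d + 1) → U) → Y → ℝ) := {Q | uncodedLoss PU W loss c +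
    potential W loss c b ≤
      stepValue W loss c (fun v y => b (Fin.init v) * PU (v (Fin.last d)) * Q v y)}
  have hS : Convex ℝ S := by
    intro Q₁ h₁ Q₂ h₂ s t hs ht hst
    have h₁' := mul_le_mul_of_nonneg_left (Set.mem_ofPred.1 h₁) hs
    have h₂' := mul_le_mul_of_nonneg_left (Set.mem_ofPred.1 h₂) ht
    have h := (add_le_add h₁' h₂').trans (stepValue_concave loss c hs ht _ _)
    rw [← add_mul, hst, one_mul] at h
    refine h.trans_eq ?_
    congr 1
    funext v y
    simp only [Pi.add_apply, Pi.smul_apply, smul_eq_mul]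
    ring
  have hsub : (Set.univ.pi fun _ : Fin (d + 1) → U => Set.range W) ⊆ S := by
    intro Q hQ
    choose a ha using fun v => hQ v (Set.mem_univ v)
    obtain rfl : (fun v => W (a v)) = Q := funext ha
    exact uncodedLoss_add_potential_le PU loss c hW hPU hd hcond hb a
  have hconv := convexHull_min hsub hS
  -- The hull of a product is the product of the hulls, so the row Q v may be mixed separately for
  -- each window v.
  rw [convexHull_pi] at hconv
  exact hconv fun v _ => hQ v

/-- The homogeneous form, applicable to the joint weights of a window and a fixed output string. -/
theorem mul_uncodedLoss_add_potential_le (hW : ∀ x y, 0 ≤ W x y)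
    (hPU : PU ∈ stdSimplex ℝ U) {d : ℕ} (hd : 1 ≤ d)
    (hcond : ∀ (v : Fin (d + 1) → U), ∀ β ∈ stdSimplex ℝ (Fin (d + 1) → U), 0 < β v →
      ∀ a, condLHS PU W loss c v β ≤ condRHS PU W loss c v β a)
    {b : (Fin d → U) → ℝ} (hb : ∀ w, 0 ≤ b w) (Q : (Fin (d + 1) → U) → Y → ℝ)
    (hQ : ∀ v, Q v ∈ convexHull ℝ (Set.range W)) :
    (∑ w, b w) * uncodedLoss PU W loss c + potential W loss c b ≤
      stepValue W loss c (fun v y => b (Fin.init v) * PU (v (Fin.last d)) * Q v y) := by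
  rcases (Finset.sum_nonneg fun w _ => hb w : 0 ≤ ∑ w, b w).eq_or_lt with h0 | h0
  · have hz : b = fun _ => 0 :=
      funext fun w => (Finset.sum_eq_zero_iff_of_nonneg fun w _ => hb w).1 h0.symm w (mem_univ w)
    subst hz
    have hc : ∀ {n : ℕ} (k : Fin n), coordLaw (fun _ : Fin n → U => 0) k = fun _ => 0 :=
      fun k => funext fun u => Finset.sum_const_zero
    simp [potential, stepValue, hc, bayesEnvelope_zero]
  · set Z := ∑ w, b w
    have hmem : (fun w => b w / Z) ∈ stdSimplex ℝ (Fin d → U) :=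
      ⟨fun w => div_nonneg (hb w) h0.le, by rw [← Finset.sum_div, div_self h0.ne']⟩
    have h := mul_le_mul_of_nonneg_left (uncodedLoss_add_potential_le_of_mem_convexHull PU loss c
      hW hPU hd hcond hmem Q hQ) h0.le
    have h1 : Z * potential W loss c (fun w => b w / Z) = potential W loss c b := by
      simp only [potential, Finset.mul_sum, ← bayesEnvelope_const_mul loss h0.le, coordLaw_div]
      refine Finset.sum_congr rfl fun k _ => Finset.sum_congr rfl fun z _ => ?_
      congr 1
      funext u
      field_simp
    rw [mul_add, h1] at h
    refine h.trans ?_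
    -- Concavity with second coefficient 0 supplies the one direction of homogeneity that is needed.
    have h2 := stepValue_concave (W := W) loss c h0.le le_rfl
      (fun v y => b (Fin.init v) / Z * PU (v (Fin.last d)) * Q v y) (fun _ _ => 0)
    rw [zero_mul, add_zero] at h2
    refine h2.trans_eq ?_
    congr 1
    funext v y
    field_simp
    ring

end Mixture

/-! ### Reindexing source strings -/

section Append

theorem append_snoc_tail_castLE {U : Type*} {d N : ℕ} (p : Fin N → U) (v : Fin (d + 1) → U) {M : ℕ}
    (h : M ≤ N + 1 + d) (h' : M ≤ N + (d + 1)) (j : Fin M) :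
    Fin.append (Fin.snoc (α := fun _ => U) p (v 0)) (Fin.tail v) (Fin.castLE h j) =
      Fin.append p v (Fin.castLE h' j) := by
  rcases j with ⟨j, hj⟩
  simp only [Fin.append, Fin.addCases, Fin.castLE_mk, Fin.snoc, Fin.tail, 
    Fin.subNat, Fin.val_cast, eq_rec_constant, Fin.castLT, Fin.castSucc]
  split_ifs with h1 h2 h3
  · rfl
  · simp only [cast_eq]
    congr 1
    ext
    simp
    omega
  · omega
  · congr 1
    ext
    simp
    omega

theorem append_init_castLE {U : Type*} {d N : ℕ} (p : Fin N → U) (v : Fin (d + 1) → U) {M : ℕ}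
    (h : M ≤ N + d) (h' : M ≤ N + (d + 1)) (j : Fin M) :
    Fin.append p (Fin.init v) (Fin.castLE h j) = Fin.append p v (Fin.castLE h' j) := by
  rcases j with ⟨j, hj⟩
  simp only [Fin.append, Fin.addCases, Fin.castLE_mk, Fin.init, Fin.subNat, Fin.val_cast,
    eq_rec_constant, Fin.castLT]
  split_ifs with h1
  · rfl
  · rfl

end Append

/-! ### The joint law of source and outputs -/

section Law

variable {U X Y R : Type*} [Fintype U] (PU : U → ℝ) (W : X → Y → ℝ) {d : ℕ}
  (π : Policy U X Y R d)

theorem sum_prod_eq_one {PU : U → ℝ} (hPU : ∑ u, PU u = 1) (n : ℕ) :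
    ∑ w : Fin n → U, ∏ i, PU (w i) = 1 := by
  induction n with
  | zero => simp
  | succ n ih =>
    rw [sum_fun_cons]
    simp only [Fin.prod_univ_succ, Fin.cons_zero, Fin.cons_succ, ← Finset.mul_sum, ih, mul_one,
      hPU]

/-- One more time step adds two factors: the newly seen source symbol, last in the window v, and the
channel output z. Both splittings describe the same string; only the boundary between past and
window moves. -/
theorem jointProb_succ (N : ℕ) (p : Fin N → U) (v : Fin (d + 1) → U) (y : Fin N → Y) (z : Y) :
    jointProb PU W π (N + 1) (Fin.append (Fin.snoc (α := fun _ => U) p (v 0)) (Fin.tail v))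
        (Fin.snoc (α := fun _ => Y) y z) =
      jointProb PU W π N (Fin.append p (Fin.init v)) y * PU (v (Fin.last d)) *
        W (π.enc N (Fin.append (m := N) (n := d + 1) p v) y) z := by
  have h1 : ∏ j : Fin (N + 1 + d),
      PU (Fin.append (Fin.snoc (α := fun _ => U) p (v 0)) (Fin.tail v) j) =
      (∏ j : Fin (N + d), PU (Fin.append p (Fin.init v) j)) * PU (v (Fin.last d)) := by
    rw [Fin.prod_univ_add (a := N + 1) (b := d), Fin.prod_univ_add (a := N) (b := d),
      Fin.prod_univ_castSucc (n := N)]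
    simp only [Fin.append_left, Fin.append_right, Fin.snoc_castSucc, Fin.snoc_last]
    have h := (Fin.prod_univ_succ fun j => PU (v j)).symm.trans
      (Fin.prod_univ_castSucc fun j => PU (v j))
    rw [mul_assoc, mul_assoc]
    exact congrArg (fun t => (∏ i, PU (p i)) * t) h
  rw [jointProb, jointProb, h1, Fin.prod_univ_castSucc]
  have h2 : ∀ (i : Fin N),
      π.enc i (fun j => Fin.append (Fin.snoc (α := fun _ => U) p (v 0))
          (Fin.tail v) (Fin.castLE (by omega) j))
        (fun j => Fin.snoc (α := fun _ => Y) y z (Fin.castLE (by omega) j)) =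
      π.enc i (fun j => Fin.append p (Fin.init v) (Fin.castLE (by omega) j))
        (fun j => y (Fin.castLE (by omega) j)) := by
    intro i
    congr 1
    · funext j
      exact (append_snoc_tail_castLE p v _ (by omega) j).trans
        (append_init_castLE p v (by omega) _ j).symm
    · funext j
      exact Fin.snoc_castSucc (α := fun _ => Y) z y (Fin.castLE (by omega) j)
  have h3 : π.enc N (fun j => Fin.append (Fin.snoc (α := fun _ => U) p (v 0)) (Fin.tail v)
          (Fin.castLE (by omega) j))
        (fun j => Fin.snoc (α := fun _ => Y) y z (Fin.castLE (by omega) j)) =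
      π.enc N (Fin.append (m := N) (n := d + 1) p v) y := by
    congr 1
    · funext j
      exact append_snoc_tail_castLE p v _ le_rfl j
    · funext j
      exact Fin.snoc_castSucc (α := fun _ => Y) z y j
  simp only [Fin.snoc_castSucc, Fin.snoc_last, Fin.val_castSucc, Fin.val_last]
  rw [h3]
  simp only [h2]
  ring

theorem jointProb_nonneg {PU : U → ℝ} {W : X → Y → ℝ} (hPU : ∀ u, 0 ≤ PU u)
    (hW : ∀ x y, 0 ≤ W x y) (N : ℕ) (u : Fin (N + d) → U) (y : Fin N → Y) :
    0 ≤ jointProb PU W π N u y :=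
  mul_nonneg (Finset.prod_nonneg fun _ _ => hPU _) (Finset.prod_nonneg fun _ _ => hW _ _)

/-- The joint probability of the source window `w` following the first `N` symbols and of the
first `N` channel outputs `y`. -/
noncomputable def windowProb (N : ℕ) (y : Fin N → Y) (w : Fin d → U) : ℝ :=
  ∑ p : Fin N → U, jointProb PU W π N (Fin.append p w) y

/-- The joint probability of the outputs `y` and `z` and of the source window `v` that is
available when the input for `z` is chosen. -/
noncomputable def extendedProb (N : ℕ) (y : Fin N → Y) (v : Fin (d + 1) → U) (z : Y) : ℝ :=
  ∑ p : Fin N → U, jointProb PU W π N (Fin.append p (Fin.init v)) y * PU (v (Fin.last d)) *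
    W (π.enc N (Fin.append (m := N) (n := d + 1) p v) y) z

theorem windowProb_succ (N : ℕ) (y : Fin N → Y) (z : Y) (w : Fin d → U) :
    windowProb PU W π (N + 1) (Fin.snoc (α := fun _ => Y) y z) w =
      ∑ s, extendedProb PU W π N y (Fin.cons (α := fun _ => U) s w) z := by
  rw [windowProb, sum_fun_snoc, Finset.sum_comm]
  refine Finset.sum_congr rfl fun s _ => Finset.sum_congr rfl fun p _ => ?_
  exact jointProb_succ PU W π N p (Fin.cons (α := fun _ => U) s w) y z

variable {PU W}

theorem extendedProb_nonneg (hPU : ∀ u, 0 ≤ PU u) (hW : ∀ x y, 0 ≤ W x y) (N : ℕ)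
    (y : Fin N → Y) (v : Fin (d + 1) → U) (z : Y) : 0 ≤ extendedProb PU W π N y v z :=
  Finset.sum_nonneg fun _ _ =>
    mul_nonneg (mul_nonneg (jointProb_nonneg π hPU hW N _ y) (hPU _)) (hW _ z)

theorem windowProb_nonneg (hPU : ∀ u, 0 ≤ PU u) (hW : ∀ x y, 0 ≤ W x y) (N : ℕ)
    (y : Fin N → Y) (w : Fin d → U) : 0 ≤ windowProb PU W π N y w :=
  Finset.sum_nonneg fun _ _ => jointProb_nonneg π hPU hW N _ y

theorem sum_jointProb_mul_PU_mul_W [Fintype Y] (hPU : PU ∈ stdSimplex ℝ U)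
    (hW : ∀ x : X, W x ∈ stdSimplex ℝ Y) (N : ℕ) (y : Fin N → Y) (p : Fin N → U) :
    ∑ v, ∑ z, jointProb PU W π N (Fin.append p (Fin.init v)) y * PU (v (Fin.last d)) *
      W (π.enc N (Fin.append (m := N) (n := d + 1) p v) y) z =
      ∑ w, jointProb PU W π N (Fin.append p w) y := by
  simp only [← Finset.mul_sum, (hW _).2, mul_one]
  rw [sum_fun_snoc]
  simp only [Fin.init_snoc, Fin.snoc_last, ← Finset.mul_sum, hPU.2, mul_one]

theorem sum_extendedProb [Fintype Y] (hPU : PU ∈ stdSimplex ℝ U)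
    (hW : ∀ x : X, W x ∈ stdSimplex ℝ Y) (N : ℕ) (y : Fin N → Y) :
    ∑ z, ∑ v, extendedProb PU W π N y v z = ∑ w, windowProb PU W π N y w := by
  simp only [extendedProb, windowProb]
  rw [Finset.sum_comm (γ := Fin d → U)]
  simp only [← sum_jointProb_mul_PU_mul_W π hPU hW]
  rw [Finset.sum_comm, Finset.sum_comm (γ := Fin N → U)]
  refine Finset.sum_congr rfl fun v _ => ?_
  rw [Finset.sum_comm]

theorem sum_windowProb [Fintype Y] (hPU : PU ∈ stdSimplex ℝ U)
    (hW : ∀ x : X, W x ∈ stdSimplex ℝ Y) (N : ℕ) :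
    ∑ y : Fin N → Y, ∑ w, windowProb PU W π N y w = 1 := by
  induction N with
  | zero =>
    have h := sum_prod_eq_one hPU.2 d
    simp only [windowProb, jointProb, Fin.prod_univ_add, Fin.append_left, Fin.append_right]
    simpa using h
  | succ N ih =>
    rw [sum_fun_snoc]
    simp only [windowProb_succ]
    rw [← ih]
    refine Finset.sum_congr rfl fun y _ => ?_
    rw [← sum_extendedProb π hPU hW]
    refine Finset.sum_congr rfl fun z _ => ?_
    rw [sum_fun_cons, Finset.sum_comm]

theorem jointProb_symbolPolicy (c : U → X) (δ : Y → R) (N : ℕ) (p : Fin N → U)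
    (w : Fin d → U) (y : Fin N → Y) :
    jointProb PU W (symbolPolicy c δ d) N (Fin.append p w) y =
      (∏ i, PU (p i) * W (c (p i)) (y i)) * ∏ i, PU (w i) := by
  have h : ∀ i : Fin N, (symbolPolicy c δ d).enc i
      (fun j => Fin.append p w (Fin.castLE (by omega) j))
      (fun j => y (Fin.castLE (by omega) j)) = c (p i) := fun i =>
    congrArg c (Fin.append_left p w i)
  rw [jointProb, Fin.prod_univ_add (a := N) (b := d), Finset.prod_mul_distrib]
  simp only [h, Fin.append_left, Fin.append_right]
  ring

/-- Given y and v, the input still depends on the past symbols p; averaging over p mixes rows of W.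
The weights may be renormalized unless they all vanish, in which case any row serves. -/
theorem exists_mem_convexHull_extendedProb (hPU : ∀ u, 0 ≤ PU u)
    (hW : ∀ x y, 0 ≤ W x y) [Nonempty X] (N : ℕ) (y : Fin N → Y) (v : Fin (d + 1) → U) :
    ∃ q ∈ convexHull ℝ (Set.range W), ∀ z, extendedProb PU W π N y v z =
      windowProb PU W π N y (Fin.init v) * PU (v (Fin.last d)) * q z := by
  set m : (Fin N → U) → ℝ :=
    fun p => jointProb PU W π N (Fin.append p (Fin.init v)) y * PU (v (Fin.last d)) with hm
  have hm0 : ∀ p, 0 ≤ m p := fun p => mul_nonneg (jointProb_nonneg π hPU hW N _ y) (hPU _)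
  have hsum : windowProb PU W π N y (Fin.init v) * PU (v (Fin.last d)) = ∑ p, m p := by
    rw [windowProb, Finset.sum_mul]
  rw [hsum]
  by_cases h0 : ∑ p, m p = 0
  · obtain ⟨x⟩ := ‹Nonempty X›
    refine ⟨W x, subset_convexHull ℝ _ ⟨x, rfl⟩, fun z => ?_⟩
    rw [h0, zero_mul]
    refine Finset.sum_eq_zero fun p _ => ?_
    have := (Finset.sum_eq_zero_iff_of_nonneg fun p _ => hm0 p).1 h0 p (mem_univ p)
    exact mul_eq_zero_of_left this _
  · refine ⟨∑ p, (m p / ∑ p, m p) • W (π.enc N (Fin.append (m := N) (n := d + 1) p v) y), ?_,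
      fun z => ?_⟩
    · refine (convex_convexHull ℝ _).sum_mem
        (fun p _ => div_nonneg (hm0 p) (Finset.sum_nonneg fun p _ => hm0 p)) ?_
        (fun p _ => subset_convexHull ℝ _ ⟨_, rfl⟩)
      rw [← Finset.sum_div, div_self h0]
    · simp only [Finset.sum_apply, Pi.smul_apply, smul_eq_mul, Finset.mul_sum]
      refine Finset.sum_congr rfl fun p _ => ?_
      rw [← mul_assoc, mul_div_cancel₀ _ h0]

variable [Fintype Y] (PU W) (loss : U → R → ℝ)

/-- The expected loss incurred at time `N`. -/
noncomputable def lossAt (N : ℕ) : ℝ :=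
  ∑ y : Fin N → Y, ∑ z, ∑ v, extendedProb PU W π N y v z *
    loss (v 0) (π.dec N (Fin.snoc (α := fun _ => Y) y z))

/-- The expected cumulative loss of the first `N` symbols. -/
noncomputable def totalLoss (N : ℕ) : ℝ :=
  ∑ u : Fin (N + d) → U, ∑ y : Fin N → Y, jointProb PU W π N u y *
    ∑ i : Fin N, loss (u (Fin.castAdd d i)) (π.dec i (fun j => y (Fin.castLE (by omega) j)))

theorem avgDistortion_eq (N : ℕ) :
    avgDistortion PU W loss π N = totalLoss PU W π loss N / N := by
  simp only [avgDistortion, totalLoss, Finset.sum_div]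
  refine Finset.sum_congr rfl fun u _ => Finset.sum_congr rfl fun y _ => ?_
  ring

variable {PU W}

theorem totalLoss_succ (hPU : PU ∈ stdSimplex ℝ U) (hW : ∀ x : X, W x ∈ stdSimplex ℝ Y)
    (N : ℕ) :
    totalLoss PU W π loss (N + 1) = totalLoss PU W π loss N + lossAt PU W π loss N := by
  have hL : totalLoss PU W π loss (N + 1) = ∑ p : Fin N → U, ∑ y : Fin N → Y,
      ∑ v : Fin (d + 1) → U, ∑ z,
      jointProb PU W π N (Fin.append p (Fin.init v)) y * PU (v (Fin.last d)) *
        W (π.enc N (Fin.append (m := N) (n := d + 1) p v) y) z *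
      (∑ i : Fin N, loss (p i) (π.dec i (fun j => y (Fin.castLE (by omega) j))) +
        loss (v 0) (π.dec N (Fin.snoc (α := fun _ => Y) y z))) := by
    rw [totalLoss, sum_fun_append, sum_fun_snoc]
    refine Finset.sum_congr rfl fun p _ => ?_
    rw [Finset.sum_comm (γ := Fin N → Y), sum_fun_cons]
    refine Finset.sum_congr rfl fun s _ => Finset.sum_congr rfl fun w _ => ?_
    rw [sum_fun_snoc]
    refine Finset.sum_congr rfl fun y _ => Finset.sum_congr rfl fun z _ => ?_
    have h := jointProb_succ PU W π N p (Fin.cons (α := fun _ => U) s w) y z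
    rw [Fin.cons_zero, Fin.tail_cons] at h
    rw [h, Fin.sum_univ_castSucc]
    simp only [Fin.append_left, Fin.snoc_castSucc, Fin.snoc_last, Fin.cons_zero]
    congr 2
    · refine Finset.sum_congr rfl fun i _ => ?_
      congr 2
      funext j
      exact Fin.snoc_castSucc (α := fun _ => Y) z y (Fin.castLE (n := (i : ℕ) + 1) i.isLt j)
  rw [hL]
  simp only [mul_add, Finset.sum_add_distrib]
  congr 1
  · rw [totalLoss, sum_fun_append]
    refine Finset.sum_congr rfl fun p _ => ?_
    rw [Finset.sum_comm (γ := Fin d → U)]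
    refine Finset.sum_congr rfl fun y _ => ?_
    simp only [Fin.append_left]
    simp only [← Finset.sum_mul]
    rw [sum_jointProb_mul_PU_mul_W π hPU hW]
  · rw [lossAt, Finset.sum_comm]
    refine Finset.sum_congr rfl fun y _ => ?_
    simp only [extendedProb, Finset.sum_mul]
    rw [Finset.sum_comm]
    conv_rhs => rw [Finset.sum_comm]
    refine Finset.sum_congr rfl fun v _ => ?_
    rw [Finset.sum_comm]

end Law

/-! ### Telescoping and the lower bound for all schemes -/

section Bounds

variable {U X Y R : Type*} [Fintype U] [Fintype Y] {PU : U → ℝ} {W : X → Y → ℝ} {d : ℕ}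
  (π : Policy U X Y R d) (loss : U → R → ℝ) (c : U → X)

theorem lossAt_le (hPU : PU ∈ stdSimplex ℝ U) (hW : ∀ x : X, W x ∈ stdSimplex ℝ Y) {M : ℝ}
    (hM : ∀ u r, loss u r ≤ M) (N : ℕ) : lossAt PU W π loss N ≤ M := by
  have h : lossAt PU W π loss N ≤ ∑ y : Fin N → Y, ∑ z, ∑ v, extendedProb PU W π N y v z * M :=
    Finset.sum_le_sum fun y _ => Finset.sum_le_sum fun z _ => Finset.sum_le_sum fun v _ =>
      mul_le_mul_of_nonneg_left (hM _ _)
        (extendedProb_nonneg π hPU.1 (fun x => (hW x).1) N y v z)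
  simp only [← Finset.sum_mul, sum_extendedProb π hPU hW, sum_windowProb π hPU hW, one_mul] at h
  exact h

theorem totalLoss_zero : totalLoss PU W π loss 0 = 0 := by
  simp [totalLoss]

theorem totalLoss_le (hPU : PU ∈ stdSimplex ℝ U) (hW : ∀ x : X, W x ∈ stdSimplex ℝ Y) {M : ℝ}
    (hM : ∀ u r, loss u r ≤ M) (N : ℕ) : totalLoss PU W π loss N ≤ N * M := by
  induction N with
  | zero => simp [totalLoss_zero]
  | succ N ih =>
    rw [totalLoss_succ π loss hPU hW]
    push_cast
    linarith [lossAt_le π loss hPU hW hM N]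

variable [DecidableEq U]

/-- The expected potential after `N` channel uses. -/
noncomputable def expectedPotential (PU : U → ℝ) (W : X → Y → ℝ) (N : ℕ) : ℝ :=
  ∑ y : Fin N → Y, potential W loss c (windowProb PU W π N y)

theorem expectedPotential_nonneg [Nonempty R] (hPU : ∀ u, 0 ≤ PU u)
    (hW : ∀ x y, 0 ≤ W x y) (hloss : ∀ u r, 0 ≤ loss u r) (N : ℕ) : 0 ≤ expectedPotential π loss c PU W N :=
  Finset.sum_nonneg fun y _ =>
    potential_nonneg loss c hloss hW (windowProb_nonneg π hPU hW N y)

variable [Finite R]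

/-- The actual reconstruction is one competitor in the envelope for component 0, and summing that
component out leaves the next window. -/
theorem stepValue_extendedProb_le (N : ℕ) (y : Fin N → Y) :
    stepValue W loss c (extendedProb PU W π N y) ≤
      ∑ z, ∑ v, extendedProb PU W π N y v z *
        loss (v 0) (π.dec N (Fin.snoc (α := fun _ => Y) y z)) +
      ∑ z, potential W loss c
        (windowProb PU W π (N + 1) (Fin.snoc (α := fun _ => Y) y z)) := by
  rw [stepValue, ← Finset.sum_add_distrib]
  refine Finset.sum_le_sum fun z _ => add_le_add ?_ (le_of_eq ?_)
  · refine (bayesEnvelope_le loss _ (π.dec N (Fin.snoc (α := fun _ => Y) y z))).trans_eq ?_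
    exact sum_coordLaw_mul (fun v => extendedProb PU W π N y v z) 0 (fun u => loss u _)
  · rw [potential, show windowProb PU W π (N + 1) (Fin.snoc (α := fun _ => Y) y z) = _ from
      funext (windowProb_succ PU W π N y z)]
    simp only [coordLaw_cons (fun v => extendedProb PU W π N y v z)]

variable [Nonempty R]

theorem potential_le (hW : ∀ x : X, W x ∈ stdSimplex ℝ Y) {M : ℝ}
    (hM : ∀ u r, loss u r ≤ M) {n : ℕ} {m : (Fin n → U) → ℝ} (hm : ∀ v, 0 ≤ m v) :
    potential W loss c m ≤ n * M * ∑ v, m v := by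
  obtain ⟨r⟩ := ‹Nonempty R›
  have h : ∀ k : Fin n, ∑ z, bayesEnvelope loss (fun u => coordLaw m k u * W (c u) z) ≤
      M * ∑ v, m v := by
    intro k
    calc ∑ z, bayesEnvelope loss (fun u => coordLaw m k u * W (c u) z)
        ≤ ∑ z, ∑ u, coordLaw m k u * W (c u) z * loss u r :=
          Finset.sum_le_sum fun z _ => bayesEnvelope_le loss _ r
      _ ≤ ∑ z, ∑ u, coordLaw m k u * W (c u) z * M :=
          Finset.sum_le_sum fun z _ => Finset.sum_le_sum fun u _ =>
            mul_le_mul_of_nonneg_left (hM u r)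
              (mul_nonneg (coordLaw_nonneg hm k u) ((hW _).1 z))
      _ = M * ∑ v, m v := by
          rw [Finset.sum_comm]
          simp only [← Finset.sum_mul, ← Finset.mul_sum, (hW _).2, mul_one, sum_coordLaw]
          ring
  calc potential W loss c m ≤ ∑ _k : Fin n, M * ∑ v, m v := Finset.sum_le_sum fun k _ => h k
    _ = n * M * ∑ v, m v := by simp [mul_assoc]

theorem expectedPotential_le (hPU : PU ∈ stdSimplex ℝ U) (hW : ∀ x : X, W x ∈ stdSimplex ℝ Y)
    {M : ℝ} (hM : ∀ u r, loss u r ≤ M) (N : ℕ) :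
    expectedPotential π loss c PU W N ≤ d * M := by
  have h : expectedPotential π loss c PU W N ≤
      ∑ y : Fin N → Y, d * M * ∑ w, windowProb PU W π N y w :=
    Finset.sum_le_sum fun y _ =>
      potential_le loss c hW hM (windowProb_nonneg π hPU.1 (fun x => (hW x).1) N y)
  rwa [← Finset.mul_sum, sum_windowProb π hPU hW, mul_one] at h

theorem uncodedLoss_add_expectedPotential_le (hPU : PU ∈ stdSimplex ℝ U)
    (hW : ∀ x : X, W x ∈ stdSimplex ℝ Y) (hd : 1 ≤ d)
    (hcond : ∀ (v : Fin (d + 1) → U), ∀ β ∈ stdSimplex ℝ (Fin (d + 1) → U), 0 < β v →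
      ∀ a, condLHS PU W loss c v β ≤ condRHS PU W loss c v β a) (N : ℕ) :
    uncodedLoss PU W loss c + expectedPotential π loss c PU W N ≤
      lossAt PU W π loss N + expectedPotential π loss c PU W (N + 1) := by
  have hW0 : ∀ x y, 0 ≤ W x y := fun x => (hW x).1
  have hU : Nonempty U := by
    by_contra h
    have := hPU.2
    rw [not_nonempty_iff] at h
    simp at this
  have : Nonempty X := hU.map c
  have h : ∀ y : Fin N → Y, (∑ w, windowProb PU W π N y w) * uncodedLoss PU W loss c +
      potential W loss c (windowProb PU W π N y) ≤
        stepValue W loss c (extendedProb PU W π N y) := by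
    intro y
    choose Q hQ hJ using exists_mem_convexHull_extendedProb π hPU.1 hW0 N y
    have h := mul_uncodedLoss_add_potential_le PU loss c hW0 hPU hd hcond
      (windowProb_nonneg π hPU.1 hW0 N y) Q hQ
    simp only [← hJ] at h
    exact h
  have h' := Finset.sum_le_sum fun y (_ : y ∈ univ) =>
    (h y).trans (stepValue_extendedProb_le π loss c N y)
  rw [Finset.sum_add_distrib, Finset.sum_add_distrib, ← Finset.sum_mul,
    sum_windowProb π hPU hW, one_mul] at h'
  refine h'.trans_eq ?_
  congr 1
  rw [expectedPotential, sum_fun_snoc]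

theorem mul_uncodedLoss_le_totalLoss (hloss : ∀ u r, 0 ≤ loss u r)
    (hPU : PU ∈ stdSimplex ℝ U) (hW : ∀ x : X, W x ∈ stdSimplex ℝ Y) (hd : 1 ≤ d)
    (hcond : ∀ (v : Fin (d + 1) → U), ∀ β ∈ stdSimplex ℝ (Fin (d + 1) → U), 0 < β v →
      ∀ a, condLHS PU W loss c v β ≤ condRHS PU W loss c v β a)
    {M : ℝ} (hM : ∀ u r, loss u r ≤ M) (N : ℕ) :
    N * uncodedLoss PU W loss c - d * M ≤ totalLoss PU W π loss N := by
  have h : N * uncodedLoss PU W loss c ≤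
      totalLoss PU W π loss N + expectedPotential π loss c PU W N := by
    induction N with
    | zero => simpa [totalLoss_zero] using
        expectedPotential_nonneg π loss c hPU.1 (fun x => (hW x).1) hloss 0
    | succ N ih =>
      rw [totalLoss_succ π loss hPU hW]
      push_cast
      linarith [uncodedLoss_add_expectedPotential_le π loss c hPU hW hd hcond N]
  linarith [expectedPotential_le π loss c hPU hW hM N]

theorem uncodedLoss_le_distortion (hloss : ∀ u r, 0 ≤ loss u r)
    (hPU : PU ∈ stdSimplex ℝ U) (hW : ∀ x : X, W x ∈ stdSimplex ℝ Y) (hd : 1 ≤ d)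
    (hcond : ∀ (v : Fin (d + 1) → U), ∀ β ∈ stdSimplex ℝ (Fin (d + 1) → U), 0 < β v →
      ∀ a, condLHS PU W loss c v β ≤ condRHS PU W loss c v β a) :
    uncodedLoss PU W loss c ≤ distortion PU W loss π := by
  obtain ⟨M, hM⟩ := (Set.finite_range fun p : U × R => loss p.1 p.2).bddAbove
  have hM' : ∀ u r, loss u r ≤ M := fun u r => hM ⟨(u, r), rfl⟩
  set l := uncodedLoss PU W loss c
  have hlim : Filter.Tendsto (fun N : ℕ => l - d * M / (N : ℝ)) Filter.atTop (nhds l) := by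
    simpa using tendsto_const_nhds.sub (tendsto_const_div_atTop_nhds_zero_nat (d * M))
  rw [← hlim.limsup_eq, distortion]
  -- In ℝ the comparison also requires the average distortions to be eventually bounded above; M is
  -- such a bound.
  refine Filter.limsup_le_limsup ?_ hlim.isCoboundedUnder_le ?_
  · filter_upwards [Filter.eventually_gt_atTop 0] with N hN
    have hN' : (0 : ℝ) < N := by exact_mod_cast hN
    have h := mul_uncodedLoss_le_totalLoss π loss c hloss hPU hW hd hcond hM' N
    rw [avgDistortion_eq, le_div_iff₀ hN', sub_mul, div_mul_cancel₀ _ hN'.ne']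
    linarith
  · refine Filter.isBoundedUnder_of_eventually_le (a := M) ?_
    filter_upwards [Filter.eventually_gt_atTop 0] with N hN
    have hN' : (0 : ℝ) < N := by exact_mod_cast hN
    rw [avgDistortion_eq, div_le_iff₀ hN', mul_comm]
    exact totalLoss_le π loss hPU hW hM' N

end Bounds

/-! ### The loss of uncoded transmission -/

section Uncoded

variable {U X Y R : Type*} [Fintype U] [Fintype Y] {PU : U → ℝ} {W : X → Y → ℝ} {d : ℕ}
  {loss : U → R → ℝ} (c : U → X) {δ : Y → R}

theorem lossAt_symbolPolicy (hPU : PU ∈ stdSimplex ℝ U) (hW : ∀ x : X, W x ∈ stdSimplex ℝ Y)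
    (N : ℕ) :
    lossAt PU W (symbolPolicy c δ d) loss N =
      ∑ z, ∑ u, PU u * W (c u) z * loss u (δ z) := by
  set A : (Fin N → Y) → ℝ := fun y => ∑ p : Fin N → U, ∏ i, PU (p i) * W (c (p i)) (y i)
    with hA
  have hA1 : ∑ y, A y = 1 := by
    -- A is the law of the past outputs: the future window factors out and sums to 1.
    rw [← sum_windowProb (symbolPolicy c δ d) hPU hW N]
    refine Finset.sum_congr rfl fun y _ => ?_
    simp only [windowProb, jointProb_symbolPolicy, ← Finset.sum_mul, ← Finset.mul_sum,
      sum_prod_eq_one hPU.2, mul_one, hA]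
  have hE : ∀ y v z, extendedProb PU W (symbolPolicy c δ d) N y v z =
      A y * (∏ j, PU (v j)) * W (c (v 0)) z := by
    intro y v z
    have henc : ∀ p : Fin N → U, (symbolPolicy c δ d).enc N
        (Fin.append (m := N) (n := d + 1) p v) y = c (v 0) := fun p =>
      congrArg c (Fin.append_right p v 0)
    simp only [extendedProb, henc, jointProb_symbolPolicy, hA, Finset.sum_mul]
    refine Finset.sum_congr rfl fun p _ => ?_
    rw [Fin.prod_univ_castSucc (fun j => PU (v j)), ← mul_assoc]
    rfl
  have hdec : ∀ (y : Fin N → Y) (z : Y), (symbolPolicy c δ d).dec N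
      (Fin.snoc (α := fun _ => Y) y z) = δ z := fun y z =>
    congrArg δ (Fin.snoc_last (α := fun _ => Y) z y)
  rw [lossAt]
  simp only [hE, hdec]
  have hs : ∀ (y : Fin N → Y) (z : Y), ∑ v : Fin (d + 1) → U,
      A y * (∏ j, PU (v j)) * W (c (v 0)) z * loss (v 0) (δ z) =
        A y * ∑ u, PU u * W (c u) z * loss u (δ z) := by
    intro y z
    rw [sum_fun_cons, Finset.mul_sum]
    refine Finset.sum_congr rfl fun u _ => ?_
    simp only [Fin.prod_univ_succ, Fin.cons_zero, Fin.cons_succ]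
    rw [← Finset.sum_mul, ← Finset.sum_mul, ← Finset.mul_sum, ← Finset.mul_sum,
      sum_prod_eq_one hPU.2]
    ring
  simp only [hs, ← Finset.mul_sum]
  rw [← Finset.sum_mul, hA1, one_mul]

theorem distortion_symbolPolicy (hPU : PU ∈ stdSimplex ℝ U)
    (hW : ∀ x : X, W x ∈ stdSimplex ℝ Y) :
    distortion PU W loss (symbolPolicy c δ d) =
      ∑ z, ∑ u, PU u * W (c u) z * loss u (δ z) := by
  set l := ∑ z, ∑ u, PU u * W (c u) z * loss u (δ z)
  have h : ∀ N : ℕ, totalLoss PU W (symbolPolicy c δ d) loss N = N * l := by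
    intro N
    induction N with
    | zero => simp [totalLoss_zero]
    | succ N ih =>
      rw [totalLoss_succ _ loss hPU hW, ih, lossAt_symbolPolicy c hPU hW]
      push_cast
      ring
  refine Filter.Tendsto.limsup_eq (tendsto_const_nhds.congr' ?_)
  filter_upwards [Filter.eventually_gt_atTop 0] with N hN
  have hN' : (N : ℝ) ≠ 0 := by exact_mod_cast hN.ne'
  rw [avgDistortion_eq, h, mul_div_cancel_left₀ _ hN']

theorem sum_loss_eq_uncodedLoss [Finite R] [Nonempty R] (hPU : ∀ u, 0 ≤ PU u)
    (hW : ∀ x y, 0 ≤ W x y)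
    (hδ : ∀ y, IsBayesResponse loss (posterior W c PU y) (δ y)) :
    ∑ z, ∑ u, PU u * W (c u) z * loss u (δ z) = uncodedLoss PU W loss c := by
  rw [uncodedLoss, Finset.sum_comm (γ := U)]
  refine Finset.sum_congr rfl fun z _ => ?_
  rw [← Finset.sum_mul, (hδ z).bayesEnvelope_eq, Finset.mul_sum]
  refine Finset.sum_congr rfl fun u _ => ?_
  rw [← mul_assoc]
  congr 1
  -- At an output of probability zero every joint weight vanishes, so the choice of δ there is
  -- irrelevant.
  by_cases h0 : ∑ u', PU u' * W (c u') z = 0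
  · rw [h0, zero_mul]
    exact (Finset.sum_eq_zero_iff_of_nonneg fun u _ => mul_nonneg (hPU u) (hW _ z)).1 h0 u
      (mem_univ u)
  · rw [posterior, mul_div_cancel₀ _ h0]

end Uncoded

end RealTimeCoding

/-! ### Optimality of uncoded transmission -/

theorem corollary1 {U X Y R : Type*} [Fintype U] [DecidableEq U] [Fintype X] [Fintype Y]
    [Fintype R] [Nonempty R]
    (PU : U → ℝ) (hPU : PU ∈ stdSimplex ℝ U)
    (W : X → Y → ℝ) (hW : ∀ x : X, W x ∈ stdSimplex ℝ Y)
    (loss : U → R → ℝ) (hloss : ∀ (u : U) (r : R), 0 ≤ loss u r)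
    (c : U ↪ X) (d : ℕ) (hd : 1 ≤ d)
    (hcond : ∀ (v : Fin (d + 1) → U), ∀ β ∈ stdSimplex ℝ (Fin (d + 1) → U), 0 < β v →
      ∃ a : (Fin (d + 1) → U) → X,
        (∀ a' : (Fin (d + 1) → U) → X,
          RealTimeCoding.condRHS PU W loss c v β a ≤ RealTimeCoding.condRHS PU W loss c v β a') ∧
        RealTimeCoding.condLHS PU W loss c v β = RealTimeCoding.condRHS PU W loss c v β a) :
    (∃ δ : Y → R,
      ∀ y : Y, RealTimeCoding.IsBayesResponse loss (RealTimeCoding.posterior W c PU y) (δ y)) ∧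
    ∀ δ : Y → R,
      (∀ y : Y,
        RealTimeCoding.IsBayesResponse loss (RealTimeCoding.posterior W c PU y) (δ y)) →
      RealTimeCoding.symbolPolicy c δ d ∈ RealTimeCoding.optimalPolicies PU W loss d := by
  have hW0 : ∀ x y, 0 ≤ W x y := fun x => (hW x).1
  refine ⟨?_, fun δ hδ => ?_⟩
  · choose δ hδ using fun y => Finite.exists_min
      fun r => ∑ u, RealTimeCoding.posterior W c PU y u * loss u r
    exact ⟨δ, fun y r => hδ y r⟩
  · have hle : ∀ π : RealTimeCoding.Policy U X Y R d,
        RealTimeCoding.uncodedLoss PU W loss c ≤ RealTimeCoding.distortion PU W loss π := fun π =>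
      RealTimeCoding.uncodedLoss_le_distortion π loss c hloss hPU hW hd fun v β hβ hv a => by
        obtain ⟨a₀, hmin, heq⟩ := hcond v β hβ hv
        exact heq.trans_le (hmin a)
    have heq : RealTimeCoding.distortion PU W loss (RealTimeCoding.symbolPolicy c δ d) =
        RealTimeCoding.uncodedLoss PU W loss c :=
      (RealTimeCoding.distortion_symbolPolicy c hPU hW).trans
        (RealTimeCoding.sum_loss_eq_uncodedLoss c hPU.1 hW0 hδ)
    have : Nonempty (RealTimeCoding.Policy U X Y R d) := ⟨RealTimeCoding.symbolPolicy c δ d⟩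
    refine heq.trans (le_antisymm (le_ciInf hle) ?_)
    -- The lower bound `hle` also supplies the boundedness that a real infimum requires.
    exact (ciInf_le ⟨_, Set.forall_mem_range.2 hle⟩ (RealTimeCoding.symbolPolicy c δ d)).trans_eq
      heq
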